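/- Lemma 3.4 (monotonic property of $\Psi$). Let $D_1,D_2\subset\mathbb R^2$ be bounded nonempty open sets (not necessarily connected) with disjoint closures, and put $\Omega=\mathbb R^2\setminus\overline{D_1\cup D_2}$. Denote by $\Psi[D_1,D_2]$ the solution $h$ of $$\Delta h=0\ \text{ in }\Omega,\qquad h(x)=O(|x|^{-1})\ \text{ as }|x|\to\infty,\qquad h|_{\partial D_i}=k_i\ (\text{constant}),\qquad \int_{\partial D_i}\partial_\nu h\,dS=(-1)^i\quad(i=1,2),$$ where $h$ is continuous up to the boundary, the constants $k_1,k_2$ are not prescribed, and $\nu$ is the unit normal that is outward for $\Omega$ (directed into $D_i$). Since no regularity of $\partial D_i$ is assumed, the flux $\int_{\partial D_i}\partial_\nu h\,dS$ is understood in the usual weak sense: it is the value of $\int_\Omega\nabla h\cdot\nabla\chi\,dx$ for any (equivalently, every) $\chi\in C_c^\infty(\mathbb R^2)$ which equals $1$ near $\overline{D_i}$ and $0$ near the closure of the other set. Let $D_A\subseteq\widetilde D_A$ and $D_B\subseteq\widetilde D_B$ be bounded nonempty open subsets of $\mathbb R^2$ such that the closures of $\widetilde D_A$ and $\widetilde D_B$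 are disjoint, and suppose that $\Psi[D_A,D_B]$ and $\Psi[\widetilde D_A,\widetilde D_B]$ exist. Then $$0\le\Psi[\widetilde D_A,\widetilde D_B]\big|_{\partial\widetilde D_B}-\Psi[\widetilde D_A,\widetilde D_B]\big|_{\partial\widetilde D_A}\le\Psi[D_A,D_B]\big|_{\partial D_B}-\Psi[D_A,D_B]\big|_{\partial D_A}.$$ -/

import Mathlib

open scoped Topology ContDiff

/-- The Euclidean plane. -/
abbrev Plane : Type := EuclideanSpace ℝ (Fin 2)

/-- The region outside the two inclusions. -/
def exteriorRegion (D₁ D₂ : Set Plane) : Set Plane := (closure (D₁ ∪ D₂))ᶜ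

/-- `HasBoundaryFlux h D E c` says that the flux of `∇ h` through the boundary of the inclusion `D`,
in the presence of the other inclusion `E`, equals `c`, i.e. `∫_{∂D} ∂_ν h dS = c`, where `ν` is the
normal that is outward for the exterior region (it points into `D`).

No regularity of `∂D` is assumed, so the boundary integral is the usual variational one: for a
function `h` harmonic in the exterior region `Ω` and a smooth compactly supported `χ` which is `1`
near `closure D` and `0` near `closure E`, the divergence theorem reads
`∫_Ω ⟪∇ h, ∇ χ⟫ = ∫_{∂Ω} χ ∂_ν h dS = ∫_{∂D} ∂_ν h dS`.
The value does not depend on `χ`, and the integrand is continuous with compact support in `Ω`. -/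
def HasBoundaryFlux (h : Plane → ℝ) (D E : Set Plane) (c : ℝ) : Prop :=
  ∀ χ : Plane → ℝ, ContDiff ℝ ∞ χ → HasCompactSupport χ →
    (∀ᶠ x in 𝓝ˢ (closure D), χ x = 1) → (∀ᶠ x in 𝓝ˢ (closure E), χ x = 0) →
    ∫ x in exteriorRegion D E, inner ℝ (gradient h x) (gradient χ x) = c

/-- `IsPsi D₁ D₂ h k₁ k₂` says that `h = Ψ[D₁, D₂]`, with constant boundary values `h = k₁` on `∂D₁`
and `h = k₂` on `∂D₂`. The values of `h` inside the inclusions play no role. -/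
structure IsPsi (D₁ D₂ : Set Plane) (h : Plane → ℝ) (k₁ k₂ : ℝ) : Prop where
  /-- `Δ h = 0` outside the closed inclusions. -/
  harmonic : InnerProductSpace.HarmonicOnNhd h (exteriorRegion D₁ D₂)
  /-- The boundary values are attained continuously from outside. -/
  continuousOn : ContinuousOn h (D₁ ∪ D₂)ᶜ
  /-- `h = O(|x|⁻¹)` as `|x| → ∞`. -/
  decay : h =O[Bornology.cobounded Plane] fun x => ‖x‖⁻¹
  boundary₁ : ∀ x ∈ frontier D₁, h x = k₁
  boundary₂ : ∀ x ∈ frontier D₂, h x = k₂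
  flux₁ : HasBoundaryFlux h D₁ D₂ (-1)
  flux₂ : HasBoundaryFlux h D₂ D₁ 1

open InnerProductSpace Filter Set MeasureTheory

/-! Write `h'` for the potential of the larger inclusions, extended by its boundary constants, and
`δ'`, `δ` for the potential differences of `h'` and `h`. Since `h'` is constant on the larger
inclusions, it is formally a test function for both potentials. The flux conditions give `∫ |∇h'|² =
δ' = ∫ ∇h·∇h'`, while the energy of `h` outside the larger inclusions is at most `δ`. Hence `δ' ≥
0`, and `2 ∇h·∇h' ≤ |∇h|² + |∇h'|²` yields `2δ' ≤ δ + δ'`.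

As `h'` need be neither smooth across the boundary nor compactly supported, it is replaced by `p ∘
h'` with `p` from `exists_contDiff_flat_near`, at a cost of order `ε`. Its gradient is `w ∇h'` with
`w = p'(h') ∈ [0, 1]`, so all integrals carry the weight `w`. The two identities come from
`IsPsi.integral_truncation_mul_inner`, the bound for `h` from
`IsPsi.integral_mul_sq_norm_gradient_le`. -/

/-! ### Smoothness of harmonic functions in the plane. -/

theorem laplacian_comp_linearIsometryEquiv {E F : Type*} [NormedAddCommGroup E]
    [InnerProductSpace ℝ E] [FiniteDimensional ℝ E] [NormedAddCommGroup F] [InnerProductSpace ℝ F]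
    [FiniteDimensional ℝ F] (e : E ≃ₗᵢ[ℝ] F) (f : F → ℝ) (x : E) :
    Laplacian.laplacian (f ∘ e) x = Laplacian.laplacian f (e x) := by
  rw [laplacian_eq_iteratedFDeriv_orthonormalBasis _ (stdOrthonormalBasis ℝ E),
    laplacian_eq_iteratedFDeriv_orthonormalBasis _ ((stdOrthonormalBasis ℝ E).map e)]
  refine Finset.sum_congr rfl fun i _ => ?_
  have := e.toContinuousLinearEquiv.iteratedFDerivWithin_comp_right f uniqueDiffOn_univ
    (x := x) (mem_univ _) 2
  simp only [preimage_univ, iteratedFDerivWithin_univ] at this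
  change iteratedFDeriv ℝ 2 (f ∘ e.toContinuousLinearEquiv) x _ = _
  rw [this]
  simp only [ContinuousMultilinearMap.compContinuousLinearMap_apply]
  congr 1
  ext j
  fin_cases j <;> simp

theorem InnerProductSpace.HarmonicAt.comp_linearIsometryEquiv {E F : Type*} [NormedAddCommGroup E]
    [InnerProductSpace ℝ E] [FiniteDimensional ℝ E] [NormedAddCommGroup F] [InnerProductSpace ℝ F]
    [FiniteDimensional ℝ F] (e : E ≃ₗᵢ[ℝ] F) {f : F → ℝ} {x : E} (h : HarmonicAt f (e x)) :
    HarmonicAt (f ∘ e) x := by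
  refine ⟨h.1.comp x e.toContinuousLinearEquiv.contDiff.contDiffAt, ?_⟩
  filter_upwards [e.continuous.continuousAt.eventually h.2] with y hy
  simpa [laplacian_comp_linearIsometryEquiv] using hy

/-- Harmonic functions on `ℂ` are analytic; an isometry `ℂ ≃ Plane` transports this. -/
theorem InnerProductSpace.HarmonicAt.contDiffAt_plane {h : Plane → ℝ} {x : Plane}
    (hh : HarmonicAt h x) : ContDiffAt ℝ ∞ h x := by
  let e : ℂ ≃ₗᵢ[ℝ] Plane := Complex.orthonormalBasisOneI.repr
  have h1 : HarmonicAt (h ∘ e) (e.symm x) :=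
    HarmonicAt.comp_linearIsometryEquiv e (by simpa using hh)
  have h2 : ContDiffAt ℝ ∞ (h ∘ e) (e.symm x) := (_root_.HarmonicAt.analyticAt h1).contDiffAt
  have h3 := h2.comp x (g := h ∘ e) e.symm.toContinuousLinearEquiv.contDiff.contDiffAt
  have : (h ∘ e) ∘ e.symm = h := by
    ext y
    simp
  rwa [this] at h3

/-! ### Auxiliary smooth functions. -/

/-- A smooth nondecreasing function close to the identity, with derivative at most one, that is
locally constant near `0`, `a` and `b`. -/
theorem exists_contDiff_flat_near (a b : ℝ) {ε : ℝ} (hε : 0 < ε) :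
    ∃ φ : ℝ → ℝ, ContDiff ℝ ∞ φ ∧ φ 0 = 0 ∧ (∀ t, 0 ≤ deriv φ t) ∧ (∀ t, deriv φ t ≤ 1) ∧
      (∀ t, |t - φ t| ≤ ε) ∧ ∀ c, c = 0 ∨ c = a ∨ c = b → ∀ᶠ t in 𝓝 c, φ t = φ c := by
  have hδ : 0 < ε / 12 := by positivity
  -- Outer radius `ε / 6` gives each bump integral at most `ε / 3`, so three bumps cost at most `ε`.
  let β : ∀ c : ℝ, ContDiffBump c := fun c => ⟨ε / 12, ε / 6, hδ, by linarith⟩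
  let g : ℝ → ℝ := fun t => (1 - β 0 t) * ((1 - β a t) * (1 - β b t))
  have hβ0 : ∀ c t, 0 ≤ β c t := fun c t => (β c).nonneg
  have hβ1 : ∀ c t, β c t ≤ 1 := fun c t => (β c).le_one
  have hβs : ∀ c, ContDiff ℝ ∞ (β c) := fun c => (β c).contDiff
  have hg : ContDiff ℝ ∞ g := by
    have := hβs 0; have := hβs a; have := hβs b
    fun_prop
  have hg0 : ∀ t, 0 ≤ g t := fun t =>
    mul_nonneg (sub_nonneg.2 (hβ1 _ _)) (mul_nonneg (sub_nonneg.2 (hβ1 _ _)) (sub_nonneg.2 (hβ1 _ _)))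
  have hg1 : ∀ t, g t ≤ 1 := fun t => by
    have h1 : (1 - β a t) * (1 - β b t) ≤ 1 :=
      mul_le_one₀ (by linarith [hβ0 a t]) (by linarith [hβ1 b t]) (by linarith [hβ0 b t])
    exact mul_le_one₀ (by linarith [hβ0 0 t])
      (mul_nonneg (sub_nonneg.2 (hβ1 _ _)) (sub_nonneg.2 (hβ1 _ _))) h1
  have hgβ : ∀ t, 1 - g t ≤ β 0 t + β a t + β b t := fun t => by
    have h1 : (1 - β a t) * (1 - β b t) ≥ 1 - β a t - β b t := by
      nlinarith [mul_nonneg (hβ0 a t) (hβ0 b t)]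
    have h2 : g t ≥ (1 - β 0 t) * (1 - β a t - β b t) :=
      mul_le_mul_of_nonneg_left h1 (sub_nonneg.2 (hβ1 _ _))
    nlinarith [mul_nonneg (hβ0 0 t) (hβ0 a t), mul_nonneg (hβ0 0 t) (hβ0 b t)]
  have hgc : Continuous g := hg.continuous
  let φ : ℝ → ℝ := fun t => ∫ s in (0 : ℝ)..t, g s
  have hφd : ∀ t, HasDerivAt φ (g t) t := fun t =>
    intervalIntegral.integral_hasDerivAt_right (hgc.intervalIntegrable _ _)
      hgc.aestronglyMeasurable.stronglyMeasurableAtFilter hgc.continuousAt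
  have hderiv : deriv φ = g := funext fun t => (hφd t).deriv
  have hβi : ∀ c, Integrable (β c) := fun c =>
    (hβs c).continuous.integrable_of_hasCompactSupport (β c).hasCompactSupport
  have hβI : ∀ c, ∫ t, β c t ≤ ε / 3 := fun c => by
    refine ((β c).integral_le_measure_closedBall (μ := volume)).trans ?_
    simp only [measureReal_def, Real.volume_closedBall]
    rw [ENNReal.toReal_ofReal (by positivity)]
    change 2 * (ε / 6) ≤ _
    linarith
  have hsum : Integrable fun t => β 0 t + β a t + β b t := ((hβi 0).add (hβi a)).add (hβi b)
  refine ⟨φ, ?_, by simp [φ], fun t => by rw [hderiv]; exact hg0 t,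
    fun t => by rw [hderiv]; exact hg1 t, fun t => ?_, fun c hc => ?_⟩
  · rw [contDiff_infty_iff_deriv, hderiv]
    exact ⟨fun t => (hφd t).differentiableAt, hg⟩
  · have h1 : t - φ t = ∫ s in (0 : ℝ)..t, (1 - g s) := by
      rw [intervalIntegral.integral_sub (by simp) (hgc.intervalIntegrable _ _)]
      simp [φ]
    rw [h1]
    refine (intervalIntegral.norm_integral_le_integral_norm_uIoc (f := fun s => 1 - g s)).trans ?_
    calc ∫ s in uIoc 0 t, ‖1 - g s‖ ≤ ∫ s in uIoc 0 t, (β 0 s + β a s + β b s) := by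
          refine setIntegral_mono (((continuous_const.sub hgc).norm.integrableOn_uIoc))
            hsum.integrableOn fun s => ?_
          change ‖1 - g s‖ ≤ _
          rw [Real.norm_of_nonneg (by linarith [hg1 s])]
          exact hgβ s
      _ ≤ ∫ s, (β 0 s + β a s + β b s) :=
          setIntegral_le_integral hsum (Eventually.of_forall fun s =>
            add_nonneg (add_nonneg (hβ0 _ _) (hβ0 _ _)) (hβ0 _ _))
      _ = (∫ s, β 0 s) + (∫ s, β a s) + ∫ s, β b s := by
          rw [integral_add (f := fun s => β 0 s + β a s) ((hβi 0).add (hβi a)) (hβi b),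
            integral_add (hβi 0) (hβi a)]
      _ ≤ ε := by linarith [hβI 0, hβI a, hβI b]
  · have hz : ∀ t ∈ Metric.ball c (ε / 12), g t = 0 := fun t ht => by
      have : β c t = 1 := (β c).one_of_mem_closedBall (Metric.ball_subset_closedBall ht)
      rcases hc with rfl | rfl | rfl <;> simp [g, this]
    filter_upwards [Metric.ball_mem_nhds c hδ] with t ht
    exact Metric.isOpen_ball.is_const_of_deriv_eq_zero (convex_ball c _).isPreconnected
      (fun s _ => (hφd s).differentiableAt.differentiableWithinAt)
      (fun s hs => by simpa [hderiv] using hz s hs) ht (Metric.mem_ball_self hδ)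

/-- Disjoint compact sets in the plane are separated by a smooth compactly supported function. -/
theorem exists_contDiff_cutoff {K L : Set Plane} (hK : IsCompact K) (hL : IsClosed L)
    (hKL : Disjoint K L) :
    ∃ χ : Plane → ℝ, ContDiff ℝ ∞ χ ∧ HasCompactSupport χ ∧
      (∀ᶠ x in 𝓝ˢ K, χ x = 1) ∧ ∀ᶠ x in 𝓝ˢ L, χ x = 0 := by
  obtain ⟨U, hU, hKU, hUL, hUc⟩ := exists_open_between_and_isCompact_closure hK hL.isOpen_compl
    hKL.subset_compl_right
  obtain ⟨f, hf0, hf1, -⟩ := exists_contMDiffMap_zero_one_nhds_of_isClosed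
    (n := ⊤) (modelWithCornersSelf ℝ Plane) hU.isClosed_compl hK.isClosed
    (disjoint_compl_left_iff_subset.2 hKU)
  refine ⟨f, f.contMDiff.contDiff, ?_, hf1, ?_⟩
  · refine HasCompactSupport.intro hUc fun x hx => ?_
    exact hf0.self_of_nhdsSet x fun hxU => hx (subset_closure hxU)
  · have : (closure U)ᶜ ∈ 𝓝ˢ L := isClosed_closure.isOpen_compl.mem_nhdsSet.2
      (subset_compl_comm.1 hUL)
    filter_upwards [this] with x hx
    exact hf0.self_of_nhdsSet x fun hxU => hx (subset_closure hxU)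

/-! ### The exterior region and rules for gradients. -/

theorem exteriorRegion_comm (A B : Set Plane) : exteriorRegion A B = exteriorRegion B A := by
  simp only [exteriorRegion, union_comm]

theorem isOpen_exteriorRegion (A B : Set Plane) : IsOpen (exteriorRegion A B) :=
  isClosed_closure.isOpen_compl

theorem notMem_exteriorRegion {A B : Set Plane} {x : Plane} :
    x ∉ exteriorRegion A B ↔ x ∈ closure A ∨ x ∈ closure B := by
  rw [exteriorRegion, notMem_compl_iff, closure_union, mem_union]

theorem gradient_eq_zero_of_eventuallyEq_const {f : Plane → ℝ} {x : Plane} {c : ℝ}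
    (hf : ∀ᶠ y in 𝓝 x, f y = c) : gradient f x = 0 := by
  have h1 : f =ᶠ[𝓝 x] fun _ => c := hf
  simp [gradient, h1.fderiv_eq]

theorem gradient_comp_deriv {p : ℝ → ℝ} {f : Plane → ℝ} {x : Plane}
    (hp : DifferentiableAt ℝ p (f x)) (hf : DifferentiableAt ℝ f x) :
    gradient (fun y => p (f y)) x = deriv p (f x) • gradient f x := by
  have h1 := hp.hasDerivAt.comp_hasFDerivAt x hf.hasFDerivAt
  have h2 : fderiv ℝ (fun y => p (f y)) x = deriv p (f x) • fderiv ℝ f x := h1.fderiv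
  simp [gradient, h2]

theorem gradient_mul {f g : Plane → ℝ} {x : Plane}
    (hf : DifferentiableAt ℝ f x) (hg : DifferentiableAt ℝ g x) :
    gradient (fun y => f y * g y) x = f x • gradient g x + g x • gradient f x := by
  have h2 : fderiv ℝ (fun y => f y * g y) x = f x • fderiv ℝ g x + g x • fderiv ℝ f x :=
    fderiv_fun_mul hf hg
  simp [gradient, h2]

theorem gradient_add {f g : Plane → ℝ} {x : Plane}
    (hf : DifferentiableAt ℝ f x) (hg : DifferentiableAt ℝ g x) :
    gradient (fun y => f y + g y) x = gradient f x + gradient g x := by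
  simp [gradient, fderiv_fun_add hf hg]

theorem gradient_const_mul {f : Plane → ℝ} {x : Plane} (c : ℝ) (hf : DifferentiableAt ℝ f x) :
    gradient (fun y => c * f y) x = c • gradient f x := by
  simp [gradient, fderiv_const_mul hf]

theorem ContDiffAt.continuousAt_gradient {f : Plane → ℝ} {x : Plane} (hf : ContDiffAt ℝ ∞ f x) :
    ContinuousAt (gradient f) x :=
  (toDual ℝ Plane).symm.continuous.continuousAt.comp
    (hf.fderiv_right (m := 0) (by norm_num)).continuousAt

/-- Multiplying a function that is smooth off `K` by a smooth function that vanishes near `K`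
yields a smooth function. -/
theorem contDiff_mul_of_eventually_zero {w u : Plane → ℝ} {s : Set Plane}
    (hw : ContDiff ℝ ∞ w) (hu : ∀ x ∈ s, ContDiffAt ℝ ∞ u x)
    (h0 : ∀ x ∉ s, ∀ᶠ y in 𝓝 x, w y = 0) : ContDiff ℝ ∞ fun x => w x * u x := by
  refine contDiff_iff_contDiffAt.2 fun x => ?_
  by_cases hx : x ∈ s
  · exact hw.contDiffAt.mul (hu x hx)
  · have h1 : (fun x => w x * u x) =ᶠ[𝓝 x] fun _ => 0 := by
      filter_upwards [h0 x hx] with y hy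
      simp [hy]
    exact contDiffAt_const.congr_of_eventuallyEq h1

/-! ### Weak flux identities. -/

section Flux

variable {A B : Set Plane} {h : Plane → ℝ}

theorem integrable_of_compactSupport_of_continuousAt {f : Plane → ℝ} {s : Set Plane}
    (hf : ∀ x ∈ s, ContinuousAt f x) (h0 : ∀ x ∉ s, ∀ᶠ y in 𝓝 x, f y = 0)
    (hc : HasCompactSupport f) : Integrable f := by
  refine Continuous.integrable_of_hasCompactSupport ?_ hc
  refine continuous_iff_continuousAt.2 fun x => ?_
  by_cases hx : x ∈ s
  · exact hf x hx
  · exact continuousAt_const.congr ((h0 x hx).mono fun y hy => hy.symm)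

/-- This makes the arbitrary values of `h` inside the inclusions harmless: there `∇h` is only ever
paired with zero. -/
theorem gradient_eventually_zero_of_locally_const {χ : Plane → ℝ} {a b : ℝ}
    (hχA : ∀ᶠ x in 𝓝ˢ (closure A), χ x = a) (hχB : ∀ᶠ x in 𝓝ˢ (closure B), χ x = b)
    {x : Plane} (hx : x ∉ exteriorRegion A B) : ∀ᶠ y in 𝓝 x, gradient χ y = 0 := by
  have : ∃ c, ∀ᶠ y in 𝓝 x, χ y = c := by
    rcases notMem_exteriorRegion.1 hx with hx | hx
    · exact ⟨a, eventually_nhdsSet_iff_forall.1 hχA x hx⟩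
    · exact ⟨b, eventually_nhdsSet_iff_forall.1 hχB x hx⟩
  obtain ⟨c, hc⟩ := this
  exact hc.eventually_nhds.mono fun y hy => gradient_eq_zero_of_eventuallyEq_const hy

theorem HasCompactSupport.gradient {χ : Plane → ℝ} (hχ : HasCompactSupport χ) :
    HasCompactSupport (gradient χ) :=
  (hχ.fderiv ℝ).comp_left (g := (toDual ℝ Plane).symm) (map_zero _)

theorem integrable_inner_gradient (hh : ∀ x ∈ exteriorRegion A B, ContDiffAt ℝ ∞ h x)
    {χ : Plane → ℝ} {a b : ℝ} (hχ : ContDiff ℝ ∞ χ) (hχc : HasCompactSupport χ)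
    (hχA : ∀ᶠ x in 𝓝ˢ (closure A), χ x = a) (hχB : ∀ᶠ x in 𝓝ˢ (closure B), χ x = b) :
    Integrable fun x => inner ℝ (gradient h x) (gradient χ x) := by
  refine integrable_of_compactSupport_of_continuousAt (s := exteriorRegion A B) (fun x hx => ?_)
    (fun x hx => ?_) ?_
  · exact (hh x hx).continuousAt_gradient.inner hχ.contDiffAt.continuousAt_gradient
  · filter_upwards [gradient_eventually_zero_of_locally_const hχA hχB hx] with y hy
    simp [hy]
  · refine hχc.gradient.mono' fun x hx => subset_closure fun h0 => hx ?_
    simp [h0]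

theorem setIntegral_inner_gradient {χ : Plane → ℝ} {a b : ℝ}
    (hχA : ∀ᶠ x in 𝓝ˢ (closure A), χ x = a) (hχB : ∀ᶠ x in 𝓝ˢ (closure B), χ x = b) :
    ∫ x in exteriorRegion A B, inner ℝ (gradient h x) (gradient χ x) =
      ∫ x, inner ℝ (gradient h x) (gradient χ x) := by
  refine setIntegral_eq_integral_of_forall_compl_eq_zero fun x hx => ?_
  simp [(gradient_eventually_zero_of_locally_const hχA hχB hx).self_of_nhds]

/-- Weak formulation of the flux conditions, for every test function that is constant near each
inclusion. -/
theorem integral_inner_gradient_of_flux (hh : ∀ x ∈ exteriorRegion A B, ContDiffAt ℝ ∞ h x)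
    (hA : IsCompact (closure A)) (hB : IsCompact (closure B))
    (hd : Disjoint (closure A) (closure B))
    (hf₁ : HasBoundaryFlux h A B (-1)) (hf₂ : HasBoundaryFlux h B A 1)
    {χ : Plane → ℝ} {a b : ℝ} (hχ : ContDiff ℝ ∞ χ) (hχc : HasCompactSupport χ)
    (hχA : ∀ᶠ x in 𝓝ˢ (closure A), χ x = a) (hχB : ∀ᶠ x in 𝓝ˢ (closure B), χ x = b) :
    ∫ x, inner ℝ (gradient h x) (gradient χ x) = b - a := by
  obtain ⟨α, hα, hαc, hαA, hαB⟩ := exists_contDiff_cutoff hA hB.isClosed hd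
  obtain ⟨β, hβ, hβc, hβB, hβA⟩ := exists_contDiff_cutoff hB hA.isClosed hd.symm
  have hβ₁ := hf₂ β hβ hβc hβB hβA
  rw [exteriorRegion_comm, setIntegral_inner_gradient hβA hβB] at hβ₁
  have hα₁ := hf₁ α hα hαc hαA hαB
  rw [setIntegral_inner_gradient hαA hαB] at hα₁
  -- The cutoffs correct `χ` to the values `1` near `A` and `0` near `B`, so the flux condition at
  -- `A` applies to `η`.
  let η : Plane → ℝ := fun x => (χ x + (1 - a) * α x) + (-b) * β x
  have hη : ContDiff ℝ ∞ η := by fun_prop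
  have hηc : HasCompactSupport η := (hχc.add (hαc.mul_left (f := fun _ => 1 - a))).add
    (hβc.mul_left (f := fun _ => -b))
  have hηA : ∀ᶠ x in 𝓝ˢ (closure A), η x = 1 := by
    filter_upwards [hχA, hαA, hβA] with x h1 h2 h3
    simp [η, h1, h2, h3]
  have hηB : ∀ᶠ x in 𝓝ˢ (closure B), η x = 0 := by
    filter_upwards [hχB, hαB, hβB] with x h1 h2 h3
    simp [η, h1, h2, h3]
  have h1 := hf₁ η hη hηc hηA hηB
  rw [setIntegral_inner_gradient hηA hηB] at h1
  have hdχ := hχ.differentiable (by norm_num)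
  have hdα := hα.differentiable (by norm_num)
  have hdβ := hβ.differentiable (by norm_num)
  have h2 : ∀ x, inner ℝ (gradient h x) (gradient η x) =
      (inner ℝ (gradient h x) (gradient χ x) +
        (1 - a) * inner ℝ (gradient h x) (gradient α x)) +
        (-b) * inner ℝ (gradient h x) (gradient β x) := fun x => by
    rw [gradient_add (by fun_prop) (by fun_prop), gradient_add (by fun_prop) (by fun_prop),
      gradient_const_mul _ (hdα x), gradient_const_mul _ (hdβ x)]
    simp [inner_add_right, inner_smul_right]
  have iχ := integrable_inner_gradient hh hχ hχc hχA hχB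
  have iα := (integrable_inner_gradient hh hα hαc hαA hαB).const_mul (1 - a)
  have iβ := (integrable_inner_gradient hh hβ hβc hβA hβB).const_mul (-b)
  simp only [h2] at h1
  have h3 := integral_add (iχ.add iα) iβ
  simp only [Pi.add_apply] at h3
  rw [h3, integral_add iχ iα, integral_const_mul, integral_const_mul, hα₁, hβ₁] at h1
  linarith

end Flux

/-! ### Truncated potentials as test functions. -/

section Truncation

variable {A B : Set Plane} {h : Plane → ℝ} {a b : ℝ}

open Classical in
/-- The composition `p ∘ h`, extended by the constants `p a` on `A` and `p b` on `B`. -/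
noncomputable def truncation (A B : Set Plane) (h : Plane → ℝ) (a b : ℝ) (p : ℝ → ℝ) :
    Plane → ℝ :=
  fun x => if x ∈ A then p a else if x ∈ B then p b else p (h x)

theorem truncation_of_mem_exteriorRegion {p : ℝ → ℝ} {x : Plane} (hx : x ∈ exteriorRegion A B) :
    truncation A B h a b p x = p (h x) := by
  have h1 : x ∉ A ∪ B := fun h' => hx (subset_closure h')
  rw [mem_union, not_or] at h1
  simp [truncation, h1.1, h1.2]

/-- Near `closure A` the function `h` either is not evaluated or takes values near its boundary
value. -/
theorem eventually_nhdsSet_closure (hA : IsOpen A) (hd : Disjoint (closure A) (closure B))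
    (hc : ContinuousOn h (A ∪ B)ᶜ) (ha : ∀ x ∈ frontier A, h x = a) {P : ℝ → Prop}
    (hP : ∀ᶠ t in 𝓝 a, P t) :
    ∀ᶠ x in 𝓝ˢ (closure A), x ∉ B ∧ (x ∉ A → P (h x)) := by
  refine eventually_nhdsSet_iff_forall.2 fun x hx => ?_
  have hB : ∀ᶠ y in 𝓝 x, y ∉ B :=
    (isClosed_closure.isOpen_compl.mem_nhds (hd.notMem_of_mem_left hx) :
      (closure B)ᶜ ∈ 𝓝 x) |> Filter.mem_of_superset <| compl_subset_compl.2 subset_closure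
  by_cases hxA : x ∈ A
  · filter_upwards [hB, hA.mem_nhds hxA] with y h1 h2
    exact ⟨h1, fun h3 => absurd h2 h3⟩
  · have hxf : h x = a := ha x ⟨hx, fun h1 => hxA (interior_subset h1)⟩
    have h1 := (hc x (by simpa [hxA] using hB.self_of_nhds)).eventually (hxf ▸ hP)
    rw [eventually_nhdsWithin_iff] at h1
    filter_upwards [hB, h1] with y h2 h3
    exact ⟨h2, fun h4 => h3 (by simp [h2, h4])⟩

variable {k₁ k₂ : ℝ}

theorem IsPsi.truncation_near_fst (hΨ : IsPsi A B h k₁ k₂) (hA : IsOpen A)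
    (hd : Disjoint (closure A) (closure B)) {p : ℝ → ℝ} (hp : ∀ᶠ t in 𝓝 k₁, p t = p k₁) :
    ∀ᶠ x in 𝓝ˢ (closure A), truncation A B h k₁ k₂ p x = p k₁ := by
  filter_upwards [eventually_nhdsSet_closure hA hd hΨ.continuousOn hΨ.boundary₁ hp] with x hx
  by_cases h1 : x ∈ A
  · simp [truncation, h1]
  · simpa [truncation, h1, hx.1] using hx.2 h1

theorem IsPsi.truncation_near_snd (hΨ : IsPsi A B h k₁ k₂) (hB : IsOpen B)
    (hd : Disjoint (closure A) (closure B)) {p : ℝ → ℝ} (hp : ∀ᶠ t in 𝓝 k₂, p t = p k₂) :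
    ∀ᶠ x in 𝓝ˢ (closure B), truncation A B h k₁ k₂ p x = p k₂ := by
  filter_upwards [eventually_nhdsSet_closure hB hd.symm
    (union_comm A B ▸ hΨ.continuousOn) hΨ.boundary₂ hp] with x hx
  by_cases h1 : x ∈ B
  · simp [truncation, h1, hx.1]
  · simpa [truncation, h1, hx.1] using hx.2 h1

theorem IsPsi.contDiffAt (hΨ : IsPsi A B h k₁ k₂) {x : Plane} (hx : x ∈ exteriorRegion A B) :
    ContDiffAt ℝ ∞ h x :=
  (hΨ.harmonic x hx).contDiffAt_plane

theorem IsPsi.truncation_eventuallyEq {p : ℝ → ℝ} {x : Plane} (hx : x ∈ exteriorRegion A B) :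
    truncation A B h k₁ k₂ p =ᶠ[𝓝 x] fun y => p (h y) := by
  filter_upwards [(isOpen_exteriorRegion A B).mem_nhds hx] with y hy
  exact truncation_of_mem_exteriorRegion hy

theorem IsPsi.contDiff_truncation (hΨ : IsPsi A B h k₁ k₂) (hA : IsOpen A) (hB : IsOpen B)
    (hd : Disjoint (closure A) (closure B)) {p : ℝ → ℝ} (hps : ContDiff ℝ ∞ p)
    (hp₁ : ∀ᶠ t in 𝓝 k₁, p t = p k₁) (hp₂ : ∀ᶠ t in 𝓝 k₂, p t = p k₂) :
    ContDiff ℝ ∞ (truncation A B h k₁ k₂ p) := by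
  refine contDiff_iff_contDiffAt.2 fun x => ?_
  by_cases hx : x ∈ exteriorRegion A B
  · exact (hps.contDiffAt.comp x (hΨ.contDiffAt hx)).congr_of_eventuallyEq
      (IsPsi.truncation_eventuallyEq hx)
  · rcases notMem_exteriorRegion.1 hx with hx | hx
    · exact contDiffAt_const.congr_of_eventuallyEq
        (eventually_nhdsSet_iff_forall.1 (hΨ.truncation_near_fst hA hd hp₁) x hx)
    · exact contDiffAt_const.congr_of_eventuallyEq
        (eventually_nhdsSet_iff_forall.1 (hΨ.truncation_near_snd hB hd hp₂) x hx)

/-- The potential tends to `0` at infinity, where `p` is flat. -/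
theorem IsPsi.hasCompactSupport_truncation (hΨ : IsPsi A B h k₁ k₂)
    (hA : Bornology.IsBounded A) (hB : Bornology.IsBounded B) {p : ℝ → ℝ}
    (hp : ∀ᶠ t in 𝓝 0, p t = 0) : HasCompactSupport (truncation A B h k₁ k₂ p) := by
  have h1 : Tendsto h (Bornology.cobounded Plane) (𝓝 0) :=
    hΨ.decay.trans_tendsto (tendsto_inv_atTop_zero.comp tendsto_norm_cobounded_atTop)
  have h2 : ∀ᶠ x in Bornology.cobounded Plane, truncation A B h k₁ k₂ p x = 0 := by
    filter_upwards [h1.eventually hp, Bornology.isBounded_def.1 hA, Bornology.isBounded_def.1 hB]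
      with x h3 h4 h5
    rw [mem_compl_iff] at h4 h5
    simp [truncation, h3, h4, h5]
  refine hasCompactSupport_iff_eventuallyEq.2 ?_
  rw [coclosedCompact_eq_cocompact, ← Metric.cobounded_eq_cocompact]
  exact h2

theorem eventually_deriv_eq_zero {p : ℝ → ℝ} {k : ℝ} (hp : ∀ᶠ t in 𝓝 k, p t = p k) :
    ∀ᶠ t in 𝓝 k, deriv p t = 0 :=
  hp.eventually_nhds.mono fun t ht => by
    have : p =ᶠ[𝓝 t] fun _ => p k := ht
    simp [this.deriv_eq]

/-- In this form the truncation lemmas apply to `deriv p` as well. -/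
theorem eventually_deriv_eq_self {p : ℝ → ℝ} {k : ℝ} (hp : ∀ᶠ t in 𝓝 k, p t = p k) :
    ∀ᶠ t in 𝓝 k, deriv p t = deriv p k :=
  (eventually_deriv_eq_zero hp).mono fun _ ht =>
    ht.trans (eventually_deriv_eq_zero hp).self_of_nhds.symm

theorem IsPsi.truncation_deriv_near_fst (hΨ : IsPsi A B h k₁ k₂) (hA : IsOpen A)
    (hd : Disjoint (closure A) (closure B)) {p : ℝ → ℝ} (hp : ∀ᶠ t in 𝓝 k₁, p t = p k₁) :
    ∀ᶠ x in 𝓝ˢ (closure A), truncation A B h k₁ k₂ (deriv p) x = 0 :=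
  (hΨ.truncation_near_fst hA hd (eventually_deriv_eq_self hp)).mono fun _ hx =>
    hx.trans (eventually_deriv_eq_zero hp).self_of_nhds

theorem IsPsi.truncation_deriv_near_snd (hΨ : IsPsi A B h k₁ k₂) (hB : IsOpen B)
    (hd : Disjoint (closure A) (closure B)) {p : ℝ → ℝ} (hp : ∀ᶠ t in 𝓝 k₂, p t = p k₂) :
    ∀ᶠ x in 𝓝ˢ (closure B), truncation A B h k₁ k₂ (deriv p) x = 0 :=
  (hΨ.truncation_near_snd hB hd (eventually_deriv_eq_self hp)).mono fun _ hx =>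
    hx.trans (eventually_deriv_eq_zero hp).self_of_nhds

theorem IsPsi.truncation_deriv_eventually_zero (hΨ : IsPsi A B h k₁ k₂) (hA : IsOpen A)
    (hB : IsOpen B) (hd : Disjoint (closure A) (closure B)) {p : ℝ → ℝ}
    (hp₁ : ∀ᶠ t in 𝓝 k₁, p t = p k₁) (hp₂ : ∀ᶠ t in 𝓝 k₂, p t = p k₂) {x : Plane}
    (hx : x ∉ exteriorRegion A B) :
    ∀ᶠ y in 𝓝 x, truncation A B h k₁ k₂ (deriv p) y = 0 := by
  rcases notMem_exteriorRegion.1 hx with hx | hx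
  · exact eventually_nhdsSet_iff_forall.1 (hΨ.truncation_deriv_near_fst hA hd hp₁) x hx
  · exact eventually_nhdsSet_iff_forall.1 (hΨ.truncation_deriv_near_snd hB hd hp₂) x hx

/-- The chain rule holds even off the exterior region, because the factor `p'` vanishes there. -/
theorem IsPsi.gradient_truncation (hΨ : IsPsi A B h k₁ k₂) (hA : IsOpen A) (hB : IsOpen B)
    (hd : Disjoint (closure A) (closure B)) {p : ℝ → ℝ} (hps : ContDiff ℝ ∞ p)
    (hp₁ : ∀ᶠ t in 𝓝 k₁, p t = p k₁) (hp₂ : ∀ᶠ t in 𝓝 k₂, p t = p k₂) (x : Plane) :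
    gradient (truncation A B h k₁ k₂ p) x =
      truncation A B h k₁ k₂ (deriv p) x • gradient h x := by
  by_cases hx : x ∈ exteriorRegion A B
  · rw [gradient, (IsPsi.truncation_eventuallyEq hx).fderiv_eq, ← gradient,
      truncation_of_mem_exteriorRegion hx]
    exact gradient_comp_deriv (hps.differentiable (by norm_num) _)
      ((hΨ.contDiffAt hx).differentiableAt (by norm_num))
  · rw [(gradient_eventually_zero_of_locally_const (hΨ.truncation_near_fst hA hd hp₁)
      (hΨ.truncation_near_snd hB hd hp₂) hx).self_of_nhds]
    have := (hΨ.truncation_deriv_eventually_zero hA hB hd hp₁ hp₂ hx).self_of_nhds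
    simp [this]

end Truncation

theorem truncation_mem_of_forall {A B : Set Plane} {h : Plane → ℝ} {a b : ℝ} {p : ℝ → ℝ}
    {P : ℝ → Prop} (hp : ∀ t, P (p t)) (x : Plane) : P (truncation A B h a b p x) := by
  unfold truncation
  split_ifs <;> exact hp _

/-! ### Energy identities and the energy bound. -/

section Energy

variable {A B A₀ B₀ : Set Plane} {h g : Plane → ℝ} {k₁ k₂ l₁ l₂ : ℝ}

/-- Testing the weak formulation for `g` with a truncation of `h`, where the inclusions of `h`
contain those of `g`. -/
theorem IsPsi.integral_truncation_mul_inner (hΨ : IsPsi A B h k₁ k₂) (hA : IsOpen A)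
    (hB : IsOpen B) (hbA : Bornology.IsBounded A) (hbB : Bornology.IsBounded B)
    (hd : Disjoint (closure A) (closure B)) (hg : IsPsi A₀ B₀ g l₁ l₂) (hA₀ : A₀ ⊆ A)
    (hB₀ : B₀ ⊆ B) {p : ℝ → ℝ} (hps : ContDiff ℝ ∞ p) (hp0 : p 0 = 0)
    (hp : ∀ c, c = 0 ∨ c = k₁ ∨ c = k₂ → ∀ᶠ t in 𝓝 c, p t = p c) :
    Integrable (fun x => truncation A B h k₁ k₂ (deriv p) x *
      inner ℝ (gradient g x) (gradient h x)) ∧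
    ∫ x, truncation A B h k₁ k₂ (deriv p) x * inner ℝ (gradient g x) (gradient h x) =
      p k₂ - p k₁ := by
  have hp₁ := hp k₁ (by simp)
  have hp₂ := hp k₂ (by simp)
  have hχ := hΨ.contDiff_truncation hA hB hd hps hp₁ hp₂
  have hχc := hΨ.hasCompactSupport_truncation hbA hbB (p := p) (by simpa [hp0] using hp 0 (by simp))
  have hχA := (hΨ.truncation_near_fst hA hd hp₁).filter_mono (nhdsSet_mono (closure_mono hA₀))
  have hχB := (hΨ.truncation_near_snd hB hd hp₂).filter_mono (nhdsSet_mono (closure_mono hB₀))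
  have h1 := integrable_inner_gradient (fun x hx => hg.contDiffAt hx) hχ hχc hχA hχB
  have h2 := integral_inner_gradient_of_flux (fun x hx => hg.contDiffAt hx)
    (hbA.subset hA₀).isCompact_closure (hbB.subset hB₀).isCompact_closure
    (hd.mono (closure_mono hA₀) (closure_mono hB₀)) hg.flux₁ hg.flux₂ hχ hχc hχA hχB
  simp only [hΨ.gradient_truncation hA hB hd hps hp₁ hp₂, inner_smul_right] at h1 h2
  exact ⟨h1, h2⟩

theorem IsPsi.integrable_mul_sq_norm_gradient (hΨ : IsPsi A B h k₁ k₂)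
    {w : Plane → ℝ} (hw : Continuous w) (hwc : HasCompactSupport w)
    (hw0 : ∀ x ∉ exteriorRegion A B, ∀ᶠ y in 𝓝 x, w y = 0) :
    Integrable fun x => w x * inner ℝ (gradient h x) (gradient h x) := by
  refine integrable_of_compactSupport_of_continuousAt (s := exteriorRegion A B) (fun x hx => ?_)
    (fun x hx => ?_) hwc.mul_right
  · have := (hΨ.contDiffAt hx).continuousAt_gradient
    exact hw.continuousAt.mul (this.inner this)
  · filter_upwards [hw0 x hx] with y hy
    simp [hy]

/-- Every cut-off Dirichlet energy of `Ψ[A, B]` is at most the potential difference. -/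
theorem IsPsi.integral_mul_sq_norm_gradient_le (hΨ : IsPsi A B h k₁ k₂) (hA : IsOpen A)
    (hB : IsOpen B) (hbA : Bornology.IsBounded A) (hbB : Bornology.IsBounded B)
    (hd : Disjoint (closure A) (closure B)) {w : Plane → ℝ} (hw : ContDiff ℝ ∞ w)
    (hwc : HasCompactSupport w) (hwA : ∀ᶠ x in 𝓝ˢ (closure A), w x = 0)
    (hwB : ∀ᶠ x in 𝓝ˢ (closure B), w x = 0) (hw1 : ∀ x, w x ≤ 1) :
    ∫ x, w x * inner ℝ (gradient h x) (gradient h x) ≤ k₂ - k₁ := by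
  set C : ℝ := ∫ x, |inner ℝ (gradient h x) (gradient w x)| with hC
  have hC0 : 0 ≤ C := integral_nonneg fun _ => abs_nonneg _
  have hwz : ∀ x ∉ exteriorRegion A B, ∀ᶠ y in 𝓝 x, w y = 0 := fun x hx => by
    rcases notMem_exteriorRegion.1 hx with hx | hx
    · exact eventually_nhdsSet_iff_forall.1 hwA x hx
    · exact eventually_nhdsSet_iff_forall.1 hwB x hx
  have hhs : ∀ x ∈ exteriorRegion A B, ContDiffAt ℝ ∞ h x := fun x hx => hΨ.contDiffAt hx
  -- `C` depends on `w` but not on `ε`, so the error term can be made arbitrarily small.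
  suffices H : ∀ ε > 0, ∫ x, w x * inner ℝ (gradient h x) (gradient h x) ≤
      k₂ - k₁ + ε * (2 + C) by
    refine le_of_forall_pos_le_add fun δ hδ => ?_
    have := H (δ / (2 + C)) (by positivity)
    rwa [div_mul_cancel₀ _ (by positivity)] at this
  intro ε hε
  obtain ⟨p, hps, hp0, hd0, hd1, hpε, hp⟩ := exists_contDiff_flat_near k₁ k₂ hε
  have hp₁ := hp k₁ (by simp)
  have hp₂ := hp k₂ (by simp)
  obtain ⟨hvi, hv⟩ := hΨ.integral_truncation_mul_inner hA hB hbA hbB hd hΨ Subset.rfl Subset.rfl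
    hps hp0 hp
  set v := truncation A B h k₁ k₂ (deriv p) with hvdef
  have hv0 : ∀ x, 0 ≤ v x := truncation_mem_of_forall (P := fun t => 0 ≤ t) hd0
  have hvs : ContDiff ℝ ∞ v := hΨ.contDiff_truncation hA hB hd (contDiff_infty_iff_deriv.1 hps).2
    (eventually_deriv_eq_self hp₁) (eventually_deriv_eq_self hp₂)
  -- The truncation error satisfies `|u| ≤ ε` and `∇u = (1 - v) ∇h`. Testing with `w * u` turns the
  -- missing energy `∫ w (1 - v) |∇h|²` into `-∫ u ∇h·∇w`, which is at most `ε * C`.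
  let u : Plane → ℝ := fun x => h x - p (h x)
  have hus : ∀ x ∈ exteriorRegion A B, ContDiffAt ℝ ∞ u x := fun x hx =>
    (hhs x hx).sub (hps.contDiffAt.comp x (hhs x hx))
  have hwu := contDiff_mul_of_eventually_zero hw hus hwz
  have hwuc : HasCompactSupport fun x => w x * u x := hwc.mul_right
  have hwuA : ∀ᶠ x in 𝓝ˢ (closure A), w x * u x = 0 := hwA.mono fun x hx => by simp [hx]
  have hwuB : ∀ᶠ x in 𝓝ˢ (closure B), w x * u x = 0 := hwB.mono fun x hx => by simp [hx]
  have i1 := integrable_inner_gradient hhs hwu hwuc hwuA hwuB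
  -- The integral is `0 - 0`, since `w * u` vanishes near both inclusions.
  have I1 := integral_inner_gradient_of_flux hhs hbA.isCompact_closure hbB.isCompact_closure hd
    hΨ.flux₁ hΨ.flux₂ hwu hwuc hwuA hwuB
  have i2 := hΨ.integrable_mul_sq_norm_gradient hw.continuous hwc hwz
  have i3 := hΨ.integrable_mul_sq_norm_gradient (w := fun x => w x * v x)
    (hw.continuous.mul hvs.continuous) hwc.mul_right fun x hx => (hwz x hx).mono fun y hy => by
      simp [hy]
  have i4 := (integrable_inner_gradient hhs hw hwc hwA hwB).abs
  have key : ∀ x, w x * inner ℝ (gradient h x) (gradient h x) -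
      w x * v x * inner ℝ (gradient h x) (gradient h x) -
      inner ℝ (gradient h x) (gradient (fun y => w y * u y) x) ≤
      ε * |inner ℝ (gradient h x) (gradient w x)| := fun x => by
    by_cases hx : x ∈ exteriorRegion A B
    · have hdh := (hhs x hx).differentiableAt (by norm_num)
      have hdu := (hus x hx).differentiableAt (by norm_num)
      have hq : DifferentiableAt ℝ (fun t => t - p t) (h x) :=
        differentiableAt_id.sub (hps.differentiable (by norm_num) _)
      have hu' : gradient u x = (1 - v x) • gradient h x := by
        rw [show u = fun y => (fun t => t - p t) (h y) from rfl, gradient_comp_deriv hq hdh, hvdef,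
          truncation_of_mem_exteriorRegion hx,
          deriv_fun_sub (f := fun t => t) differentiableAt_id (hps.differentiable (by norm_num) _)]
        simp
      rw [gradient_mul (hw.differentiable (by norm_num) x) hdu, hu', inner_add_right,
        inner_smul_right, inner_smul_right, inner_smul_right]
      have h1 : -(u x * inner ℝ (gradient h x) (gradient w x)) ≤
          ε * |inner ℝ (gradient h x) (gradient w x)| := by
        refine (neg_le_abs _).trans ?_
        rw [abs_mul]
        exact mul_le_mul_of_nonneg_right (hpε _) (abs_nonneg _)
      linarith
    · have h1 : gradient (fun y => w y * u y) x = 0 :=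
        (gradient_eventually_zero_of_locally_const hwuA hwuB hx).self_of_nhds
      simp only [(hwz x hx).self_of_nhds, h1]
      simp only [zero_mul, sub_zero, inner_zero_right]
      positivity
  have h1 := integral_mono ((i2.sub i3).sub i1) (i4.const_mul ε) key
  simp only [Pi.sub_apply] at h1
  have h2 := integral_sub (i2.sub i3) i1
  simp only [Pi.sub_apply] at h2
  rw [h2, integral_sub i2 i3, I1, integral_const_mul, ← hC] at h1
  have h3 : ∫ x, w x * v x * inner ℝ (gradient h x) (gradient h x) ≤ p k₂ - p k₁ := by
    rw [← hv]
    refine integral_mono i3 hvi fun x => ?_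
    exact mul_le_mul_of_nonneg_right (mul_le_of_le_one_left (hv0 x) (hw1 x))
      real_inner_self_nonneg
  have h4 := abs_le.1 (hpε k₁)
  have h5 := abs_le.1 (hpε k₂)
  linarith

end Energy

/-! ### Comparison of the two potentials. -/

theorem lemma3p4 (DA DB DA' DB' : Set Plane)
    (hDA : IsOpen DA) (hDB : IsOpen DB) (hDA' : IsOpen DA') (hDB' : IsOpen DB')
    (hbA : Bornology.IsBounded DA') (hbB : Bornology.IsBounded DB')
    (hdisj : Disjoint (closure DA') (closure DB'))
    (hA : DA ⊆ DA') (hB : DB ⊆ DB')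
    (h : Plane → ℝ) (kA kB : ℝ) (hh : IsPsi DA DB h kA kB)
    (h' : Plane → ℝ) (kA' kB' : ℝ) (hh' : IsPsi DA' DB' h' kA' kB') :
    0 ≤ kB' - kA' ∧ kB' - kA' ≤ kB - kA := by
  suffices H : ∀ ε > 0, 0 ≤ kB' - kA' + 2 * ε ∧ kB' - kA' ≤ kB - kA + 2 * ε by
    constructor
    · refine le_of_forall_pos_le_add fun δ hδ => ?_
      linarith [(H (δ / 2) (by positivity)).1]
    · refine le_of_forall_pos_le_add fun δ hδ => ?_
      linarith [(H (δ / 2) (by positivity)).2]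
  intro ε hε
  obtain ⟨p, hps, hp0, hd0, hd1, hpε, hp⟩ := exists_contDiff_flat_near kA' kB' hε
  have hp₁ := hp kA' (by simp)
  have hp₂ := hp kB' (by simp)
  obtain ⟨i1, I1⟩ := hh'.integral_truncation_mul_inner hDA' hDB' hbA hbB hdisj hh' Subset.rfl
    Subset.rfl hps hp0 hp
  -- The cross term equals the energy term in `I1`: both potentials have fluxes `-1` and `1`.
  obtain ⟨i2, I2⟩ := hh'.integral_truncation_mul_inner hDA' hDB' hbA hbB hdisj hh hA hB hps hp0 hp
  set w := truncation DA' DB' h' kA' kB' (deriv p)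
  have hw0 : ∀ x, 0 ≤ w x := truncation_mem_of_forall (P := fun t => 0 ≤ t) hd0
  have hw1 : ∀ x, w x ≤ 1 := truncation_mem_of_forall (P := fun t => t ≤ 1) hd1
  have hws : ContDiff ℝ ∞ w := hh'.contDiff_truncation hDA' hDB' hdisj
    (contDiff_infty_iff_deriv.1 hps).2 (eventually_deriv_eq_self hp₁) (eventually_deriv_eq_self hp₂)
  have hwc : HasCompactSupport w := hh'.hasCompactSupport_truncation hbA hbB
    (eventually_deriv_eq_zero (hp 0 (by simp)))
  have hwA := (hh'.truncation_deriv_near_fst hDA' hdisj hp₁).filter_mono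
    (nhdsSet_mono (closure_mono hA))
  have hwB := (hh'.truncation_deriv_near_snd hDB' hdisj hp₂).filter_mono
    (nhdsSet_mono (closure_mono hB))
  have I3 := hh.integral_mul_sq_norm_gradient_le hDA hDB (hbA.subset hA) (hbB.subset hB)
    (hdisj.mono (closure_mono hA) (closure_mono hB)) hws hwc hwA hwB hw1
  have i3 := hh.integrable_mul_sq_norm_gradient hws.continuous hwc fun x hx => by
    rcases notMem_exteriorRegion.1 hx with hx | hx
    · exact eventually_nhdsSet_iff_forall.1 hwA x hx
    · exact eventually_nhdsSet_iff_forall.1 hwB x hx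
  have h4 := abs_le.1 (hpε kA')
  have h5 := abs_le.1 (hpε kB')
  have h6 : 0 ≤ p kB' - p kA' := by
    rw [← I1]
    exact integral_nonneg fun x => mul_nonneg (hw0 x) real_inner_self_nonneg
  have h7 : 2 * (p kB' - p kA') ≤ (p kB' - p kA') + (kB - kA) := by
    calc 2 * (p kB' - p kA') = ∫ x, 2 * (w x * inner ℝ (gradient h x) (gradient h' x)) := by
          rw [integral_const_mul, I2]
      _ ≤ ∫ x, (w x * inner ℝ (gradient h' x) (gradient h' x) +
            w x * inner ℝ (gradient h x) (gradient h x)) := by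
          refine integral_mono (i2.const_mul 2) (i1.add i3) fun x => ?_
          -- Pointwise, `w |∇h - ∇h'|² ≥ 0`.
          have h8 := real_inner_self_nonneg (x := gradient h x - gradient h' x)
          rw [real_inner_sub_sub_self] at h8
          change 2 * (w x * _) ≤ w x * _ + w x * _
          nlinarith [mul_nonneg (hw0 x) h8]
      _ ≤ (p kB' - p kA') + (kB - kA) := by
          rw [integral_add i1 i3, I1]
          linarith
  constructor <;> linarith
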